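/- All graphs are finite, simple and undirected. First-order formulas about graphs are built from the atomic formulas $x=y$ and $x\sim y$ (adjacency) by Boolean connectives and quantifiers over vertices (there are no truth constants). The quantifier depth of a sentence is the maximum number of nested quantifiers in it; its variable width is the number of distinct variables used in it, where a variable may be re-quantified. A graph is $k$-connected if it has more than $k$ vertices, is connected, and remains connected after the removal of any $k-1$ vertices; $\kappa(G)$ is the maximum $k$ such that $G$ is $k$-connected, and $v(G)$ is the number of vertices of $G$. Let $\pi\in\{v,\kappa\}$. For a connected graph $F$, let $D_\pi(F)$ (resp. $W_\pi(F)$) be the minimum quantifier depth (resp. variable width) of a first-order sentence $\Phi$ for which there is a $k$ such that, for every connected graph $G$ with $\pi(G)\ge k$, $\Phi$ is true on $G$ if and only if $G$ contains a (not necessarily induced) subgraph isomorphic to $F$. Let $P_4$ be the path on 4 vertices and $C_4$ the cycle on 4 vertices. **Theorem.** 1. $W_v(P_4)=2$ and $D_v(P_4)=3$. 2. $D_\kappa(C_4)=4$ and $W_\kappa(C_4)\ge 3$. -/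

import Mathlib

/-- First-order formulas over graphs, with adjacency and equality as the only relation symbols.
Variables are named by natural numbers and may be re-used (re-quantified) freely. There are no
truth constants. -/
inductive GraphFormula : Type
  | eq (i j : ℕ) : GraphFormula
  | adj (i j : ℕ) : GraphFormula
  | neg (φ : GraphFormula) : GraphFormula
  | and (φ ψ : GraphFormula) : GraphFormula
  | or (φ ψ : GraphFormula) : GraphFormula
  | ex (i : ℕ) (φ : GraphFormula) : GraphFormula
  | all (i : ℕ) (φ : GraphFormula) : GraphFormula

namespace GraphFormula

/-- The set of variables with a free occurrence. -/
def freeVars : GraphFormula → Finset ℕ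
  | eq i j => {i, j}
  | adj i j => {i, j}
  | neg φ => φ.freeVars
  | and φ ψ => φ.freeVars ∪ ψ.freeVars
  | or φ ψ => φ.freeVars ∪ ψ.freeVars
  | ex i φ => φ.freeVars.erase i
  | all i φ => φ.freeVars.erase i

/-- The set of all variables used to build the formula, free or bound. -/
def vars : GraphFormula → Finset ℕ
  | eq i j => {i, j}
  | adj i j => {i, j}
  | neg φ => φ.vars
  | and φ ψ => φ.vars ∪ ψ.vars
  | or φ ψ => φ.vars ∪ ψ.vars
  | ex i φ => insert i φ.vars
  | all i φ => insert i φ.vars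

/-- The quantifier depth: the maximum number of nested quantifiers. -/
def depth : GraphFormula → ℕ
  | eq _ _ => 0
  | adj _ _ => 0
  | neg φ => φ.depth
  | and φ ψ => max φ.depth ψ.depth
  | or φ ψ => max φ.depth ψ.depth
  | ex _ φ => φ.depth + 1
  | all _ φ => φ.depth + 1

/-- The variable width: the number of distinct variables used to build the formula. -/
def width (φ : GraphFormula) : ℕ := φ.vars.card

/-- A sentence is a formula without free variables. -/
def IsSentence (φ : GraphFormula) : Prop := φ.freeVars = ∅

/-- Satisfaction of a formula in the graph `G` under the assignment `s` of vertices to variables. -/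
def Sat {V : Type*} (G : SimpleGraph V) : GraphFormula → (ℕ → V) → Prop
  | eq i j, s => s i = s j
  | adj i j, s => G.Adj (s i) (s j)
  | neg φ, s => ¬ Sat G φ s
  | and φ ψ, s => Sat G φ s ∧ Sat G ψ s
  | or φ ψ, s => Sat G φ s ∨ Sat G ψ s
  | ex i φ, s => ∃ v : V, Sat G φ (Function.update s i v)
  | all i φ, s => ∀ v : V, Sat G φ (Function.update s i v)

/-- Truth of a sentence in a graph with at least one vertex (the value of a sentence does not
depend on the assignment). It is only applied to connected graphs, which are non-empty. -/
def TrueOn {V : Type*} (φ : GraphFormula) (G : SimpleGraph V) : Prop :=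
  ∀ s : ℕ → V, Sat G φ s

end GraphFormula

/-- A class of finite graphs; an `n`-vertex graph has the vertex set `Fin n`. -/
abbrev GraphClass : Type := ∀ n : ℕ, SimpleGraph (Fin n) → Prop

/-- A graph parameter on finite graphs. -/
abbrev GraphParameter : Type := ∀ n : ℕ, SimpleGraph (Fin n) → ℕ

/-- The sentence `Φ` defines the class `C` over the connected graphs `G` with `π(G) ≥ k`. -/
def DefinesOver (π : GraphParameter) (k : ℕ) (C : GraphClass) (Φ : GraphFormula) : Prop :=
  Φ.IsSentence ∧
    ∀ (n : ℕ) (G : SimpleGraph (Fin n)), G.Connected → k ≤ π n G → (Φ.TrueOn G ↔ C n G)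

/-- `D_π^k(C)`: the minimum quantifier depth of a sentence that defines `C` over the connected
graphs with `π ≥ k` (`⊤` if there is none). -/
noncomputable def depthFrom (π : GraphParameter) (k : ℕ) (C : GraphClass) : ℕ∞ :=
  ⨅ (Φ : GraphFormula) (_ : DefinesOver π k C Φ), (Φ.depth : ℕ∞)

/-- `W_π^k(C)`: the minimum variable width of a sentence that defines `C` over the connected
graphs with `π ≥ k` (`⊤` if there is none). -/
noncomputable def widthFrom (π : GraphParameter) (k : ℕ) (C : GraphClass) : ℕ∞ :=
  ⨅ (Φ : GraphFormula) (_ : DefinesOver π k C Φ), (Φ.width : ℕ∞)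

/-- `D_π(C)`: the minimum over all `k` of `D_π^k(C)`. -/
noncomputable def depthParam (π : GraphParameter) (C : GraphClass) : ℕ∞ :=
  ⨅ k : ℕ, depthFrom π k C

/-- `W_π(C)`: the minimum over all `k` of `W_π^k(C)`. -/
noncomputable def widthParam (π : GraphParameter) (C : GraphClass) : ℕ∞ :=
  ⨅ k : ℕ, widthFrom π k C

/-- The class of all graphs that contain a (not necessarily induced) subgraph isomorphic
to `F`. -/
def subgraphClass {α : Type*} (F : SimpleGraph α) : GraphClass :=
  fun _ G => F.IsContained G

/-- The number of vertices, as a graph parameter. -/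
def vertexCount : GraphParameter := fun n _ => n

/-- A graph on `n` vertices is `k`-connected if `n > k`, it is connected, and it remains connected
after the removal of any `k - 1` vertices. -/
def IsKConnected {n : ℕ} (k : ℕ) (G : SimpleGraph (Fin n)) : Prop :=
  k < n ∧ G.Connected ∧
    ∀ S : Finset (Fin n), S.card + 1 = k → (G.induce {v | v ∉ S}).Connected

/-- The connectivity: the maximum `k` such that the graph is `k`-connected (such `k` are smaller
than the number of vertices, and `k = 0` is one of them if the graph is connected). -/
noncomputable def connectivity : GraphParameter :=
  fun _ G => sSup {k : ℕ | IsKConnected k G}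

/-! For $P_4$: a connected graph with at least four vertices and no $P_4$ is a star, and the stars
are the graphs in which every edge has exactly one universal end
(`pathGraph_four_isContained_iff_of_connected`). Universality is expressible by re-quantifying one
of two variables, which gives width 2 and depth 3. Conversely, a star and the same star with one
extra edge agree on all sentences of depth 2 (`backForth_two`), and one variable separates no two
non-empty graphs.

For $C_4$: the obvious sentence has depth 4. For the lower bounds, compare the point-line incidence
graphs of the affine plane over $\mathbb{F}_p$ and over $\mathbb{F}_p\times\mathbb{F}_p$. A $C_4$ is
a pair of points on two common lines; a field excludes it, zero divisors create it. Both graphs are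
bipartite and satisfy the same extension properties (`TriangleFreeRich`), which settle the
three-round game and the two-variable game. Their connectivity grows with $p$
(`connected_induce_compl`). -/

namespace GraphFormula

/-! ### Semantics: free variables and isomorphism invariance -/

variable {V W : Type*}

/-- Satisfaction only depends on the values of the free variables. -/
theorem sat_congr (G : SimpleGraph V) (φ : GraphFormula) :
    ∀ s t : ℕ → V, (∀ i ∈ φ.freeVars, s i = t i) → (Sat G φ s ↔ Sat G φ t) := by
  induction φ with
  | eq i j => intro s t h; simp [freeVars] at h; simp [Sat, h]
  | adj i j => intro s t h; simp [freeVars] at h; simp [Sat, h]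
  | neg φ ih => intro s t h; exact not_congr (ih s t h)
  | and φ ψ ih₁ ih₂ =>
    intro s t h
    exact and_congr (ih₁ s t fun i hi => h i (Finset.mem_union_left _ hi))
      (ih₂ s t fun i hi => h i (Finset.mem_union_right _ hi))
  | or φ ψ ih₁ ih₂ =>
    intro s t h
    exact or_congr (ih₁ s t fun i hi => h i (Finset.mem_union_left _ hi))
      (ih₂ s t fun i hi => h i (Finset.mem_union_right _ hi))
  | ex i φ ih =>
    intro s t h
    refine exists_congr fun v => ih _ _ fun j hj => ?_
    by_cases hji : j = i
    · subst hji; simp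
    · simp [hji, h j (Finset.mem_erase.2 ⟨hji, hj⟩)]
  | all i φ ih =>
    intro s t h
    refine forall_congr' fun v => ih _ _ fun j hj => ?_
    by_cases hji : j = i
    · subst hji; simp
    · simp [hji, h j (Finset.mem_erase.2 ⟨hji, hj⟩)]

theorem IsSentence.trueOn_iff_sat {φ : GraphFormula} (hφ : φ.IsSentence) (G : SimpleGraph V)
    (s : ℕ → V) : φ.TrueOn G ↔ Sat G φ s :=
  ⟨fun h => h s, fun h t => (sat_congr G φ s t (by simp [show φ.freeVars = ∅ from hφ])).1 h⟩

theorem sat_iso {G : SimpleGraph V} {H : SimpleGraph W} (e : G ≃g H) (φ : GraphFormula) :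
    ∀ s : ℕ → V, Sat G φ s ↔ Sat H φ (e ∘ s) := by
  induction φ with
  | eq i j => intro s; simp [Sat]
  | adj i j => intro s; exact e.map_adj_iff.symm
  | neg φ ih => intro s; exact not_congr (ih s)
  | and φ ψ ih₁ ih₂ => intro s; exact and_congr (ih₁ s) (ih₂ s)
  | or φ ψ ih₁ ih₂ => intro s; exact or_congr (ih₁ s) (ih₂ s)
  | ex i φ ih =>
    intro s
    refine e.toEquiv.exists_congr fun v => ?_
    rw [ih, Function.comp_update]; rfl
  | all i φ ih =>
    intro s
    refine e.toEquiv.forall_congr fun v => ?_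
    rw [ih, Function.comp_update]; rfl

theorem IsSentence.trueOn_iso {φ : GraphFormula} (hφ : φ.IsSentence) {G : SimpleGraph V}
    {H : SimpleGraph W} (e : G ≃g H) [Nonempty V] : φ.TrueOn G ↔ φ.TrueOn H := by
  let s : ℕ → V := fun _ => Classical.arbitrary V
  rw [hφ.trueOn_iff_sat G s, hφ.trueOn_iff_sat H (e ∘ s), sat_iso e]

/-! ### Ehrenfeucht games -/

/-- The pairs in the list form a partial isomorphism. -/
def PartialIso (G : SimpleGraph V) (H : SimpleGraph W) (l : List (V × W)) : Prop :=
  ∀ p ∈ l, ∀ q ∈ l, (p.1 = q.1 ↔ p.2 = q.2) ∧ (G.Adj p.1 q.1 ↔ H.Adj p.2 q.2)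

/-- Duplicator wins the `k`-round Ehrenfeucht game from the position `l`. -/
def BackForth (G : SimpleGraph V) (H : SimpleGraph W) : ℕ → List (V × W) → Prop
  | 0, l => PartialIso G H l
  | k + 1, l => PartialIso G H l ∧ (∀ v, ∃ w, BackForth G H k ((v, w) :: l)) ∧
      ∀ w, ∃ v, BackForth G H k ((v, w) :: l)

theorem BackForth.partialIso {G : SimpleGraph V} {H : SimpleGraph W} {k : ℕ} {l : List (V × W)}
    (h : BackForth G H k l) : PartialIso G H l := by
  cases k with
  | zero => exact h
  | succ k => exact h.1

theorem PartialIso.symm {G : SimpleGraph V} {H : SimpleGraph W} {l : List (V × W)}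
    (h : PartialIso G H l) : PartialIso H G (l.map Prod.swap) := by
  intro p hp q hq
  rw [List.mem_map] at hp hq
  obtain ⟨p, hp, rfl⟩ := hp
  obtain ⟨q, hq, rfl⟩ := hq
  exact ⟨(h p hp q hq).1.symm, (h p hp q hq).2.symm⟩

/-- Duplicator's replies carry witnesses across each quantifier. Only the current values of the free
variables have to occur in `l`; pairs left over from re-quantified variables do no harm. -/
theorem BackForth.sat_iff {G : SimpleGraph V} {H : SimpleGraph W} (φ : GraphFormula) :
    ∀ (k : ℕ) (l : List (V × W)) (s : ℕ → V) (t : ℕ → W), φ.depth ≤ k → BackForth G H k l →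
      (∀ i ∈ φ.freeVars, (s i, t i) ∈ l) → (Sat G φ s ↔ Sat H φ t) := by
  have key : ∀ (i : ℕ) (φ : GraphFormula) (l : List (V × W)) (s : ℕ → V) (t : ℕ → W) (v : V)
      (w : W), (∀ j ∈ φ.freeVars.erase i, (s j, t j) ∈ l) → ∀ j ∈ φ.freeVars,
      (Function.update s i v j, Function.update t i w j) ∈ (v, w) :: l := by
    intro i φ l s t v w h j hj
    by_cases hji : j = i
    · subst hji; simp
    · simpa [hji] using Or.inr (h j (Finset.mem_erase.2 ⟨hji, hj⟩))
  induction φ with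
  | eq i j =>
    intro k l s t _ hl h
    exact (hl.partialIso _ (h i (by simp [freeVars])) _ (h j (by simp [freeVars]))).1
  | adj i j =>
    intro k l s t _ hl h
    exact (hl.partialIso _ (h i (by simp [freeVars])) _ (h j (by simp [freeVars]))).2
  | neg φ ih => intro k l s t hk hl h; exact not_congr (ih k l s t hk hl h)
  | and φ ψ ih₁ ih₂ =>
    intro k l s t hk hl h
    exact and_congr
      (ih₁ k l s t ((le_max_left _ _).trans hk) hl fun i hi => h i (Finset.mem_union_left _ hi))
      (ih₂ k l s t ((le_max_right _ _).trans hk) hl fun i hi => h i (Finset.mem_union_right _ hi))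
  | or φ ψ ih₁ ih₂ =>
    intro k l s t hk hl h
    exact or_congr
      (ih₁ k l s t ((le_max_left _ _).trans hk) hl fun i hi => h i (Finset.mem_union_left _ hi))
      (ih₂ k l s t ((le_max_right _ _).trans hk) hl fun i hi => h i (Finset.mem_union_right _ hi))
  | ex i φ ih =>
    intro k l s t hk hl h
    obtain _ | k := k
    · simp [depth] at hk
    have hk' : φ.depth ≤ k := Nat.le_of_succ_le_succ hk
    constructor
    · rintro ⟨v, hv⟩
      obtain ⟨w, hw⟩ := hl.2.1 v
      exact ⟨w, (ih k _ _ _ hk' hw (key i φ l s t v w h)).1 hv⟩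
    · rintro ⟨w, hv⟩
      obtain ⟨v, hw⟩ := hl.2.2 w
      exact ⟨v, (ih k _ _ _ hk' hw (key i φ l s t v w h)).2 hv⟩
  | all i φ ih =>
    intro k l s t hk hl h
    obtain _ | k := k
    · simp [depth] at hk
    have hk' : φ.depth ≤ k := Nat.le_of_succ_le_succ hk
    constructor
    · intro hv w
      obtain ⟨v, hw⟩ := hl.2.2 w
      exact (ih k _ _ _ hk' hw (key i φ l s t v w h)).1 (hv v)
    · intro hv v
      obtain ⟨w, hw⟩ := hl.2.1 v
      exact (ih k _ _ _ hk' hw (key i φ l s t v w h)).2 (hv w)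

theorem IsSentence.trueOn_iff_of_backForth {φ : GraphFormula} (hφ : φ.IsSentence)
    {G : SimpleGraph V} {H : SimpleGraph W} [Nonempty V] [Nonempty W] {k : ℕ}
    (hk : φ.depth ≤ k) (h : BackForth G H k []) : φ.TrueOn G ↔ φ.TrueOn H := by
  rw [hφ.trueOn_iff_sat G fun _ => Classical.arbitrary V,
    hφ.trueOn_iff_sat H fun _ => Classical.arbitrary W]
  exact BackForth.sat_iff φ k [] _ _ hk h (by simp [show φ.freeVars = ∅ from hφ])

/-! ### Formulas with one or two variables -/

/-- One variable does not tell non-empty graphs apart. -/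
theorem sat_iff_of_vars_subset_singleton (G : SimpleGraph V) (H : SimpleGraph W)
    [Nonempty V] [Nonempty W] (x : ℕ) (φ : GraphFormula) :
    φ.vars ⊆ {x} → ∀ (s : ℕ → V) (t : ℕ → W), Sat G φ s ↔ Sat H φ t := by
  induction φ with
  | eq i j =>
    intro h s t
    have hi : i = x := by simpa using h (show i ∈ _ by simp [vars])
    have hj : j = x := by simpa using h (show j ∈ _ by simp [vars])
    simp [Sat, hi, hj]
  | adj i j =>
    intro h s t
    have hi : i = x := by simpa using h (show i ∈ _ by simp [vars])
    have hj : j = x := by simpa using h (show j ∈ _ by simp [vars])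
    simp [Sat, hi, hj]
  | neg φ ih => intro h s t; exact not_congr (ih h s t)
  | and φ ψ ih₁ ih₂ =>
    intro h s t
    exact and_congr (ih₁ (Finset.union_subset_left h) s t) (ih₂ (Finset.union_subset_right h) s t)
  | or φ ψ ih₁ ih₂ =>
    intro h s t
    exact or_congr (ih₁ (Finset.union_subset_left h) s t) (ih₂ (Finset.union_subset_right h) s t)
  | ex i φ ih =>
    intro h s t
    have hφ := ih ((Finset.subset_insert _ _).trans h)
    exact ⟨fun ⟨v, hv⟩ => ⟨Classical.arbitrary W, (hφ _ _).1 hv⟩,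
      fun ⟨v, hv⟩ => ⟨Classical.arbitrary V, (hφ _ _).2 hv⟩⟩
  | all i φ ih =>
    intro h s t
    have hφ := ih ((Finset.subset_insert _ _).trans h)
    exact ⟨fun hv w => (hφ _ _).1 (hv (Classical.arbitrary V)),
      fun hv w => (hφ _ _).2 (hv (Classical.arbitrary W))⟩

/-- Every vertex has a neighbour and another vertex that is not a neighbour. -/
def NoExtremeVertex (G : SimpleGraph V) : Prop :=
  ∀ x, (∃ y, G.Adj x y) ∧ ∃ y, y ≠ x ∧ ¬ G.Adj x y

theorem NoExtremeVertex.exists_match {H : SimpleGraph W} (hH : NoExtremeVertex H)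
    (G : SimpleGraph V) (x v : V) (y : W) :
    ∃ w, (v = x ↔ w = y) ∧ (G.Adj v x ↔ H.Adj w y) := by
  by_cases hvx : v = x
  · subst hvx; exact ⟨y, by simp⟩
  by_cases ha : G.Adj v x
  · obtain ⟨w, hw⟩ := (hH y).1
    exact ⟨w, by simp [hvx, hw.ne'], by simp [ha, hw.symm]⟩
  · obtain ⟨w, hwy, hw⟩ := (hH y).2
    exact ⟨w, by simp [hvx, hwy], by simp [ha, H.adj_comm w y, hw]⟩

/-- The assignments agree on the two variables `x` and `y`. -/
def AgreeOn (G : SimpleGraph V) (H : SimpleGraph W) (x y : ℕ) (s : ℕ → V) (t : ℕ → W) : Prop :=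
  (s x = s y ↔ t x = t y) ∧ (G.Adj (s x) (s y) ↔ H.Adj (t x) (t y))

theorem AgreeOn.symm {G : SimpleGraph V} {H : SimpleGraph W} {x y : ℕ} {s : ℕ → V} {t : ℕ → W}
    (h : AgreeOn G H x y s t) : AgreeOn H G x y t s := ⟨h.1.symm, h.2.symm⟩

theorem NoExtremeVertex.agreeOn_update {H : SimpleGraph W} (hH : NoExtremeVertex H)
    (G : SimpleGraph V) {x y : ℕ} (hxy : x ≠ y) (s : ℕ → V) (t : ℕ → W) {i : ℕ}
    (hi : i = x ∨ i = y) (v : V) :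
    ∃ w, AgreeOn G H x y (Function.update s i v) (Function.update t i w) := by
  rcases hi with rfl | rfl
  · obtain ⟨w, h₁, h₂⟩ := hH.exists_match G (s y) v (t y)
    exact ⟨w, by simpa [AgreeOn, hxy.symm] using ⟨h₁, h₂⟩⟩
  · obtain ⟨w, h₁, h₂⟩ := hH.exists_match G (s x) v (t x)
    refine ⟨w, ?_⟩
    simp only [AgreeOn, Function.update_self, Function.update_of_ne hxy]
    rw [eq_comm, h₁, G.adj_comm, h₂, H.adj_comm w, eq_comm (a := w)]
    exact ⟨Iff.rfl, Iff.rfl⟩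

/-- This is the two-pebble game with no bound on the rounds. Each move leaves one pebble in place,
and the new vertex is equal, adjacent or non-adjacent to it; without extreme vertices all three
options are always available. -/
theorem sat_iff_of_vars_subset_pair {G : SimpleGraph V} {H : SimpleGraph W}
    (hG : NoExtremeVertex G) (hH : NoExtremeVertex H) {x y : ℕ} (hxy : x ≠ y) (φ : GraphFormula) :
    φ.vars ⊆ {x, y} → ∀ (s : ℕ → V) (t : ℕ → W), AgreeOn G H x y s t →
      (Sat G φ s ↔ Sat H φ t) := by
  induction φ with
  | eq i j =>
    intro h s t hst
    have hi : i = x ∨ i = y := by simpa using h (show i ∈ _ by simp [vars])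
    have hj : j = x ∨ j = y := by simpa using h (show j ∈ _ by simp [vars])
    obtain ⟨h₁, h₂⟩ := hst
    rcases hi with rfl | rfl <;> rcases hj with rfl | rfl <;>
      simp_all [Sat, eq_comm]
  | adj i j =>
    intro h s t hst
    have hi : i = x ∨ i = y := by simpa using h (show i ∈ _ by simp [vars])
    have hj : j = x ∨ j = y := by simpa using h (show j ∈ _ by simp [vars])
    obtain ⟨h₁, h₂⟩ := hst
    rcases hi with rfl | rfl <;> rcases hj with rfl | rfl <;>
      simp_all [Sat, SimpleGraph.adj_comm]
  | neg φ ih => intro h s t hst; exact not_congr (ih h s t hst)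
  | and φ ψ ih₁ ih₂ =>
    intro h s t hst
    exact and_congr (ih₁ (Finset.union_subset_left h) s t hst)
      (ih₂ (Finset.union_subset_right h) s t hst)
  | or φ ψ ih₁ ih₂ =>
    intro h s t hst
    exact or_congr (ih₁ (Finset.union_subset_left h) s t hst)
      (ih₂ (Finset.union_subset_right h) s t hst)
  | ex i φ ih =>
    intro h s t hst
    have hφ := ih ((Finset.subset_insert _ _).trans h)
    have hi : i = x ∨ i = y := by simpa using h (show i ∈ _ by simp [vars])
    constructor
    · rintro ⟨v, hv⟩
      obtain ⟨w, hw⟩ := hH.agreeOn_update G hxy s t hi v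
      exact ⟨w, (hφ _ _ hw).1 hv⟩
    · rintro ⟨w, hv⟩
      obtain ⟨v, hw⟩ := hG.agreeOn_update H hxy t s hi w
      exact ⟨v, (hφ _ _ hw.symm).2 hv⟩
  | all i φ ih =>
    intro h s t hst
    have hφ := ih ((Finset.subset_insert _ _).trans h)
    have hi : i = x ∨ i = y := by simpa using h (show i ∈ _ by simp [vars])
    constructor
    · intro hv w
      obtain ⟨v, hw⟩ := hG.agreeOn_update H hxy t s hi w
      exact (hφ _ _ hw.symm).1 (hv v)
    · intro hv v
      obtain ⟨w, hw⟩ := hH.agreeOn_update G hxy s t hi v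
      exact (hφ _ _ hw).2 (hv w)

theorem IsSentence.trueOn_iff_of_width_le_two {φ : GraphFormula} (hφ : φ.IsSentence)
    {G : SimpleGraph V} {H : SimpleGraph W} [Nonempty V] [Nonempty W]
    (hG : NoExtremeVertex G) (hH : NoExtremeVertex H) (h : φ.width ≤ 2) :
    φ.TrueOn G ↔ φ.TrueOn H := by
  -- The variable set is padded to exactly two elements. Constant assignments then agree trivially
  -- at the start.
  obtain ⟨X, hX, hcard⟩ := Infinite.exists_superset_card_eq φ.vars 2 h
  obtain ⟨x, y, hxy, rfl⟩ := Finset.card_eq_two.1 hcard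
  rw [hφ.trueOn_iff_sat G fun _ => Classical.arbitrary V,
    hφ.trueOn_iff_sat H fun _ => Classical.arbitrary W]
  exact sat_iff_of_vars_subset_pair hG hH hxy φ hX _ _ (by simp [AgreeOn])

theorem IsSentence.trueOn_iff_of_width_le_one {φ : GraphFormula} (hφ : φ.IsSentence)
    (G : SimpleGraph V) (H : SimpleGraph W) [Nonempty V] [Nonempty W] (h : φ.width ≤ 1) :
    φ.TrueOn G ↔ φ.TrueOn H := by
  obtain ⟨X, hX, hcard⟩ := Infinite.exists_superset_card_eq φ.vars 1 h
  obtain ⟨x, rfl⟩ := Finset.card_eq_one.1 hcard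
  rw [hφ.trueOn_iff_sat G fun _ => Classical.arbitrary V,
    hφ.trueOn_iff_sat H fun _ => Classical.arbitrary W]
  exact sat_iff_of_vars_subset_singleton G H x φ hX _ _

/-! ### Two-round and three-round games -/

theorem exists_partialIso_pair {G : SimpleGraph V} {H : SimpleGraph W}
    (hH : ∀ x, ∃ y, H.Adj x y) {x : V} {x' : W}
    (h : (∃ y, y ≠ x ∧ ¬ G.Adj x y) → ∃ y, y ≠ x' ∧ ¬ H.Adj x' y) (v : V) :
    ∃ w, PartialIso G H [(v, w), (x, x')] := by
  have : ∃ w, (v = x ↔ w = x') ∧ (G.Adj x v ↔ H.Adj x' w) := by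
    by_cases hvx : v = x
    · subst hvx; exact ⟨x', by simp⟩
    by_cases ha : G.Adj x v
    · obtain ⟨w, hw⟩ := hH x'
      exact ⟨w, by simp [hvx, hw.ne'], by simp [ha, hw]⟩
    · obtain ⟨w, hwx, hw⟩ := h ⟨v, hvx, ha⟩
      exact ⟨w, by simp [hvx, hwx], by simp [ha, hw]⟩
  obtain ⟨w, h₁, h₂⟩ := this
  refine ⟨w, ?_⟩
  simp [PartialIso, h₁, h₂, G.adj_comm v, H.adj_comm w, eq_comm (a := x), eq_comm (a := x')]

/-- Two graphs with a universal vertex, a non-universal vertex, and without isolated vertices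
are not distinguished in two rounds. -/
theorem backForth_two {G : SimpleGraph V} {H : SimpleGraph W}
    (hG : ∀ x, ∃ y, G.Adj x y) (hH : ∀ x, ∃ y, H.Adj x y)
    (hG₁ : ∃ x, ∀ y, y ≠ x → G.Adj x y) (hH₁ : ∃ x, ∀ y, y ≠ x → H.Adj x y)
    (hG₂ : ∃ x, ∃ y, y ≠ x ∧ ¬ G.Adj x y) (hH₂ : ∃ x, ∃ y, y ≠ x ∧ ¬ H.Adj x y) :
    BackForth G H 2 [] := by
  -- With one round left, all that matters about the chosen vertices is whether both or neither are
  -- universal.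
  have next : ∀ {x : V} {x' : W},
      ((∃ y, y ≠ x ∧ ¬ G.Adj x y) ↔ ∃ y, y ≠ x' ∧ ¬ H.Adj x' y) →
      BackForth G H 1 [(x, x')] := by
    intro x x' h
    refine ⟨by simp [PartialIso], exists_partialIso_pair hH h.1, fun w => ?_⟩
    obtain ⟨v, hv⟩ := exists_partialIso_pair hG h.2 w
    exact ⟨v, hv.symm⟩
  obtain ⟨u, hu⟩ := hG₁
  obtain ⟨u', hu'⟩ := hH₁
  obtain ⟨a, ha⟩ := hG₂
  obtain ⟨a', ha'⟩ := hH₂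
  have hu₀ : ¬ ∃ y, y ≠ u ∧ ¬ G.Adj u y := fun ⟨y, hy, h⟩ => h (hu y hy)
  have hu₀' : ¬ ∃ y, y ≠ u' ∧ ¬ H.Adj u' y := fun ⟨y, hy, h⟩ => h (hu' y hy)
  refine ⟨by simp [PartialIso], fun v => ?_, fun w => ?_⟩
  · by_cases hv : ∃ y, y ≠ v ∧ ¬ G.Adj v y
    · exact ⟨a', next (iff_of_true hv ha')⟩
    · exact ⟨u', next (iff_of_false hv hu₀')⟩
  · by_cases hv : ∃ y, y ≠ w ∧ ¬ H.Adj w y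
    · exact ⟨a, next (iff_of_true ha hv)⟩
    · exact ⟨u, next (iff_of_false hu₀ hv)⟩

/-- Triangle-free graphs in which every extension by at most two further vertices that is not
excluded by triangle-freeness is realized; non-adjacent vertices may have common neighbours or
not. -/
structure TriangleFreeRich (G : SimpleGraph V) : Prop where
  triangle_free : ∀ x y z, G.Adj x y → G.Adj x z → ¬ G.Adj y z
  exists_adj : ∀ x, ∃ y, G.Adj x y
  exists_common : ∀ x, ∃ y, y ≠ x ∧ ¬ G.Adj x y ∧ ∃ c, G.Adj x c ∧ G.Adj y c
  exists_not_common : ∀ x, ∃ y, y ≠ x ∧ ¬ G.Adj x y ∧ ¬ ∃ c, G.Adj x c ∧ G.Adj y c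
  exists_neither : ∀ x y, ∃ z, z ≠ x ∧ z ≠ y ∧ ¬ G.Adj x z ∧ ¬ G.Adj y z
  exists_only : ∀ x y, x ≠ y → ∃ z, z ≠ y ∧ G.Adj x z ∧ ¬ G.Adj y z

theorem TriangleFreeRich.noExtremeVertex {G : SimpleGraph V} (hG : TriangleFreeRich G) :
    NoExtremeVertex G := fun x =>
  ⟨hG.exists_adj x, let ⟨y, h₁, h₂, _⟩ := hG.exists_common x; ⟨y, h₁, h₂⟩⟩

/-- The reply depends on which of $x$, $y$ the new vertex is adjacent to. Adjacency to both is the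
only pattern not always available for distinct vertices, and `hcom` covers it. -/
theorem TriangleFreeRich.exists_third {G : SimpleGraph V} {H : SimpleGraph W}
    (hH : TriangleFreeRich H) {x y : V} {x' y' : W} (heq : y = x ↔ y' = x')
    (hadj : G.Adj x y ↔ H.Adj x' y')
    (hcom : (∃ c, G.Adj x c ∧ G.Adj y c) ↔ ∃ c, H.Adj x' c ∧ H.Adj y' c) (z : V) :
    ∃ z', PartialIso G H [(z, z'), (y, y'), (x, x')] := by
  have : ∃ z', (z = x ↔ z' = x') ∧ (z = y ↔ z' = y') ∧ (G.Adj x z ↔ H.Adj x' z') ∧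
      (G.Adj y z ↔ H.Adj y' z') := by
    by_cases hzx : z = x
    · subst hzx
      exact ⟨x', by simp, by rw [eq_comm, heq, eq_comm], by simp,
        by rw [G.adj_comm, hadj, H.adj_comm]⟩
    by_cases hzy : z = y
    · subst hzy
      exact ⟨y', heq, by simp, hadj, by simp⟩
    by_cases hax : G.Adj x z <;> by_cases hay : G.Adj y z
    · obtain ⟨c, hc₁, hc₂⟩ := hcom.1 ⟨z, hax, hay⟩
      exact ⟨c, by simp [hzx, hc₁.ne'], by simp [hzy, hc₂.ne'], by simp [*], by simp [*]⟩
    · have hne : x' ≠ y' := fun h => hay (by rw [heq.2 h.symm]; exact hax)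
      obtain ⟨c, hc, hc₁, hc₂⟩ := hH.exists_only x' y' hne
      exact ⟨c, by simp [hzx, hc₁.ne'], by simp [hzy, hc], by simp [*], by simp [*]⟩
    · have hne : y' ≠ x' := fun h => hax (by rw [← heq.2 h]; exact hay)
      obtain ⟨c, hc, hc₁, hc₂⟩ := hH.exists_only y' x' hne
      exact ⟨c, by simp [hzx, hc], by simp [hzy, hc₁.ne'], by simp [*], by simp [*]⟩
    · obtain ⟨c, h₁, h₂, h₃, h₄⟩ := hH.exists_neither x' y'
      exact ⟨c, by simp [*], by simp [*], by simp [*], by simp [*]⟩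
  obtain ⟨z', h₁, h₂, h₃, h₄⟩ := this
  refine ⟨z', ?_⟩
  simp [PartialIso, h₁, h₂, h₃, h₄, heq, hadj, G.adj_comm z, H.adj_comm z', G.adj_comm y x,
    H.adj_comm y' x', eq_comm (a := x), eq_comm (a := x'), eq_comm (a := y) (b := z),
    eq_comm (a := y') (b := z')]

/-- Besides being a partial isomorphism, the reply must preserve the existence of a common
neighbour. This is automatic for equal vertices (none is isolated) and for adjacent ones (no
triangles). -/
theorem TriangleFreeRich.exists_second {G : SimpleGraph V} {H : SimpleGraph W}
    (hG : TriangleFreeRich G) (hH : TriangleFreeRich H) (x y : V) (x' : W) :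
    ∃ y', (y = x ↔ y' = x') ∧ (G.Adj x y ↔ H.Adj x' y') ∧
      ((∃ c, G.Adj x c ∧ G.Adj y c) ↔ ∃ c, H.Adj x' c ∧ H.Adj y' c) := by
  by_cases hyx : y = x
  · subst hyx
    exact ⟨x', by simp, by simp, iff_of_true (by simpa using hG.exists_adj y)
      (by simpa using hH.exists_adj x')⟩
  by_cases ha : G.Adj x y
  · obtain ⟨y', h⟩ := hH.exists_adj x'
    exact ⟨y', by simp [hyx, h.ne'], by simp [*], iff_of_false
      (fun ⟨c, h₁, h₂⟩ => hG.triangle_free x y c ha h₁ h₂)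
      (fun ⟨c, h₁, h₂⟩ => hH.triangle_free x' y' c h h₁ h₂)⟩
  by_cases hc : ∃ c, G.Adj x c ∧ G.Adj y c
  · obtain ⟨y', h₁, h₂, h₃⟩ := hH.exists_common x'
    exact ⟨y', by simp [*], by simp [*], iff_of_true hc h₃⟩
  · obtain ⟨y', h₁, h₂, h₃⟩ := hH.exists_not_common x'
    exact ⟨y', by simp [*], by simp [*], iff_of_false hc h₃⟩

theorem TriangleFreeRich.backForth_three {G : SimpleGraph V} {H : SimpleGraph W}
    [Nonempty V] [Nonempty W] (hG : TriangleFreeRich G) (hH : TriangleFreeRich H) :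
    BackForth G H 3 [] := by
  have second : ∀ {x y : V} {x' y' : W}, (y = x ↔ y' = x') → (G.Adj x y ↔ H.Adj x' y') →
      ((∃ c, G.Adj x c ∧ G.Adj y c) ↔ ∃ c, H.Adj x' c ∧ H.Adj y' c) →
      BackForth G H 1 [(y, y'), (x, x')] := by
    intro x y x' y' h₁ h₂ h₃
    refine ⟨?_, hH.exists_third h₁ h₂ h₃, fun w => ?_⟩
    · simp [PartialIso, h₁, h₂, eq_comm (a := x), eq_comm (a := x'), G.adj_comm y,
        H.adj_comm y']
    · obtain ⟨v, hv⟩ := hG.exists_third h₁.symm h₂.symm h₃.symm w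
      exact ⟨v, hv.symm⟩
  have first : ∀ (x : V) (x' : W), BackForth G H 2 [(x, x')] := by
    intro x x'
    refine ⟨by simp [PartialIso], fun v => ?_, fun w => ?_⟩
    · obtain ⟨w, h₁, h₂, h₃⟩ := hG.exists_second hH x v x'
      exact ⟨w, second h₁ h₂ h₃⟩
    · obtain ⟨v, h₁, h₂, h₃⟩ := hH.exists_second hG x' w x
      exact ⟨v, second h₁.symm h₂.symm h₃.symm⟩
  exact ⟨by simp [PartialIso], fun v => ⟨Classical.arbitrary W, first _ _⟩,
    fun w => ⟨Classical.arbitrary V, first _ _⟩⟩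

end GraphFormula

/-! ### Incidence graphs of affine planes -/

/-- The incidence graph of points and non-vertical lines of the affine plane over `R`: the point
`(x, y)` is on the line `(a, b)` if `y + b = a * x`. -/
def affineIncidence (R : Type*) [CommRing R] : SimpleGraph (R × R ⊕ R × R) where
  Adj
    | .inl p, .inr l => p.2 + l.2 = l.1 * p.1
    | .inr l, .inl p => p.2 + l.2 = l.1 * p.1
    | _, _ => False
  symm := ⟨by rintro (p | l) (q | m) h <;> exact h⟩
  loopless := ⟨by rintro (p | l) h <;> exact h⟩

namespace affineIncidence

variable {R : Type*} [CommRing R]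

@[simp] theorem adj_inl_inr (p l : R × R) :
    (affineIncidence R).Adj (.inl p) (.inr l) ↔ p.2 + l.2 = l.1 * p.1 := Iff.rfl

@[simp] theorem adj_inr_inl (p l : R × R) :
    (affineIncidence R).Adj (.inr l) (.inl p) ↔ p.2 + l.2 = l.1 * p.1 := Iff.rfl

@[simp] theorem not_adj_inl_inl (p q : R × R) :
    ¬ (affineIncidence R).Adj (.inl p) (.inl q) := id

@[simp] theorem not_adj_inr_inr (p q : R × R) :
    ¬ (affineIncidence R).Adj (.inr p) (.inr q) := id

/-- The lines through `p` of slopes 0 and 1 cannot both pass through another point `q`. Slopes 0 and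
1 suffice over any ring, so zero divisors do not matter. -/
theorem exists_notMem_fst {p q : R × R} (h : p ≠ q) :
    ∃ a, a * p.1 - p.2 ≠ a * q.1 - q.2 := by
  by_contra! H
  have h₀ := H 0
  have h₁ := H 1
  simp only [zero_mul, zero_sub, neg_inj, one_mul] at h₀ h₁
  rw [h₀] at h₁
  exact h (Prod.ext (sub_left_injective h₁) h₀)

theorem exists_ne_ne [Nontrivial R] (p q : R × R) : ∃ r, r ≠ p ∧ r ≠ q := by
  by_cases h : (p.1 + 1, p.2) = q
  · refine ⟨(p.1, p.2 + 1), fun h' => ?_, fun h' => ?_⟩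
    · simpa using congrArg Prod.snd h'
    · simpa using congrArg Prod.fst (h'.trans h.symm)
  · exact ⟨(p.1 + 1, p.2), fun h' => by simpa using congrArg Prod.fst h', h⟩

theorem exists_not_incident [Nontrivial R] (p l : R × R) :
    ∃ r : R × R, r ≠ p ∧ r.2 + l.2 ≠ l.1 * r.1 := by
  refine ⟨(p.1 + 1, l.1 * (p.1 + 1) - l.2 + 1), fun h => ?_, fun h => ?_⟩
  · simpa using congrArg Prod.fst h
  · have : (1 : R) = 0 := by linear_combination h
    exact one_ne_zero this

/-- The incidence equation is symmetric under exchanging points and lines. -/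
theorem exists_not_incident' [Nontrivial R] (p l : R × R) :
    ∃ r : R × R, r ≠ l ∧ p.2 + r.2 ≠ r.1 * p.1 := by
  obtain ⟨r, h₁, h₂⟩ := exists_not_incident l p
  exact ⟨r, h₁, by rwa [add_comm, mul_comm]⟩

theorem triangleFreeRich [Nontrivial R] :
    GraphFormula.TriangleFreeRich (affineIncidence R) where
  triangle_free := by rintro (x | x) (y | y) (z | z) <;> simp
  exists_adj := by
    rintro (x | x)
    · exact ⟨.inr (0, -x.2), by simp⟩
    · exact ⟨.inl (0, -x.2), by simp⟩
  exists_common := by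
    rintro (x | x)
    · exact ⟨.inl (x.1 + 1, x.2), by simp [Prod.ext_iff], by simp, .inr (0, -x.2), by simp,
        by simp⟩
    · exact ⟨.inr (x.1 + 1, x.2), by simp [Prod.ext_iff], by simp, .inl (0, -x.2), by simp,
        by simp⟩
  -- The graph is bipartite, so a point and a line never have a common neighbour; any non-incident
  -- pair will do.
  exists_not_common := by
    rintro (x | x)
    · obtain ⟨r, -, h⟩ := exists_not_incident' x 0
      exact ⟨.inr r, by simp, by simpa using h, by rintro ⟨c | c, h₁, h₂⟩ <;> simp at h₁ h₂⟩
    · obtain ⟨r, -, h⟩ := exists_not_incident 0 x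
      exact ⟨.inl r, by simp, by simpa using h, by rintro ⟨c | c, h₁, h₂⟩ <;> simp at h₁ h₂⟩
  exists_neither := by
    rintro (x | x) (y | y)
    · obtain ⟨r, h₁, h₂⟩ := exists_ne_ne x y
      exact ⟨.inl r, by simpa using h₁, by simpa using h₂, by simp, by simp⟩
    · obtain ⟨r, h₁, h₂⟩ := exists_not_incident x y
      exact ⟨.inl r, by simpa using h₁, by simp, by simp, by simpa using h₂⟩
    · obtain ⟨r, h₁, h₂⟩ := exists_not_incident y x
      exact ⟨.inl r, by simp, by simpa using h₁, by simpa using h₂, by simp⟩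
    · obtain ⟨r, h₁, h₂⟩ := exists_ne_ne x y
      exact ⟨.inr r, by simpa using h₁, by simpa using h₂, by simp, by simp⟩
  exists_only := by
    rintro (x | x) (y | y) hxy
    · obtain ⟨a, ha⟩ := exists_notMem_fst (show x ≠ y from fun h => hxy (h ▸ rfl))
      refine ⟨.inr (a, a * x.1 - x.2), by simp, by simp, fun h => ha ?_⟩
      rw [adj_inl_inr] at h
      linear_combination h
    · by_cases h : y = (0, -x.2)
      · exact ⟨.inr (1, x.1 - x.2), by simp [h], by simp, by simp⟩
      · exact ⟨.inr (0, -x.2), fun h' => h (by simpa using h'.symm), by simp, by simp⟩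
    · by_cases h : y = (0, -x.2)
      · exact ⟨.inl (1, x.1 - x.2), by simp [h], by simp, by simp⟩
      · exact ⟨.inl (0, -x.2), fun h' => h (by simpa using h'.symm), by simp, by simp⟩
    · obtain ⟨a, ha⟩ := exists_notMem_fst (show x ≠ y from fun h => hxy (h ▸ rfl))
      refine ⟨.inl (a, a * x.1 - x.2), by simp, by simp [mul_comm], fun h => ha ?_⟩
      rw [adj_inr_inl] at h
      linear_combination h

/-- Few vertices do not separate the incidence graph. -/
theorem connected_induce_compl {F : Type*} [Field F] [Fintype F] [Nontrivial R] (f : F →+* R)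
    (S : Finset (R × R ⊕ R × R)) (hS : 2 * S.card + 2 ≤ Fintype.card F) :
    ((affineIncidence R).induce {v | v ∉ S}).Connected := by
  classical
  have hf : Function.Injective f := f.injective
  have pick : ∀ B : Finset R, B.card < Fintype.card F → ∃ t : F, f t ∉ B := by
    intro B hB
    have hlt : B.card < (Finset.univ.image f).card := by
      rwa [Finset.card_image_of_injective _ hf, Finset.card_univ]
    obtain ⟨e, he, heB⟩ := Finset.exists_mem_notMem_of_card_lt_card hlt
    obtain ⟨t, -, rfl⟩ := Finset.mem_image.1 he
    exact ⟨t, heB⟩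
  -- Columns of points and slopes of lines outside `B` are untouched by `S`. The subfield image
  -- supplies such values with invertible differences.
  set B : Finset R := S.image (Sum.elim Prod.fst Prod.fst) with hB
  have hBcard : B.card ≤ S.card := Finset.card_image_le
  have point : ∀ {x} (_ : x ∉ B) (y : R), (Sum.inl (x, y) : R × R ⊕ R × R) ∉ S :=
    fun hx y h => hx (Finset.mem_image.2 ⟨_, h, rfl⟩)
  have line : ∀ {x} (_ : x ∉ B) (y : R), (Sum.inr (x, y) : R × R ⊕ R × R) ∉ S :=
    fun hx y h => hx (Finset.mem_image.2 ⟨_, h, rfl⟩)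
  let Joined (u v : R × R ⊕ R × R) : Prop := ∃ (hu : u ∉ S) (hv : v ∉ S),
    ((affineIncidence R).induce {v | v ∉ S}).Reachable ⟨u, hu⟩ ⟨v, hv⟩
  have trans : ∀ {u v w}, Joined u v → Joined v w → Joined u w :=
    fun ⟨hu, _, h⟩ ⟨_, hw, h'⟩ => ⟨hu, hw, h.trans h'⟩
  have step : ∀ {u v}, u ∉ S → v ∉ S → (affineIncidence R).Adj u v → Joined u v :=
    fun hu hv h => ⟨hu, hv, SimpleGraph.Adj.reachable (by simpa using h)⟩
  obtain ⟨t₁, h₁⟩ := pick B (by omega)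
  obtain ⟨t₂, h₂⟩ := pick (insert (f t₁) B) (by
    have := Finset.card_insert_le (f t₁) B
    omega)
  rw [Finset.mem_insert, not_or] at h₂
  obtain ⟨hne, h₂⟩ := h₂
  obtain ⟨c, hc⟩ : ∃ c, (f t₂ - f t₁) * c = 1 := by
    refine ⟨f (t₂ - t₁)⁻¹, ?_⟩
    rw [← map_sub, ← map_mul, mul_inv_cancel₀, map_one]
    exact sub_ne_zero.2 fun h => hne (h ▸ rfl)
  -- Go from column `f t₁` to column `f t₂` along slope `a` and return along slope `a - (y' - y) *
  -- c`. As `c` inverts `f t₂ - f t₁`, the height changes by exactly `y' - y`. Both slopes must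
  -- avoid `B`.
  have column : ∀ y y', Joined (.inl (f t₁, y)) (.inl (f t₁, y')) := by
    intro y y'
    obtain ⟨t, ht⟩ := pick (B ∪ B.image (· + (y' - y) * c)) (by
      have h₁ := Finset.card_union_le B (B.image (· + (y' - y) * c))
      have h₂ : (B.image (· + (y' - y) * c)).card ≤ B.card := Finset.card_image_le
      omega)
    rw [Finset.mem_union, not_or] at ht
    obtain ⟨ha, ha'⟩ := ht
    set a := f t
    have ha₂ : a - (y' - y) * c ∉ B :=
      fun h => ha' (Finset.mem_image.2 ⟨_, h, by ring⟩)
    refine trans (step (point h₁ _) (line ha (a * f t₁ - y)) ?_)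
      (trans (step (line ha _) (point h₂ (a * f t₂ - a * f t₁ + y)) ?_)
      (trans (step (point h₂ _) (line ha₂ ((a - (y' - y) * c) * f t₂ -
        (a * f t₂ - a * f t₁ + y))) ?_) (step (line ha₂ _) (point h₁ _) ?_)))
    · simp
    · simp only [adj_inr_inl]; ring
    · simp
    · simp only [adj_inr_inl]
      linear_combination (y - y') * hc
  have lines : ∀ l, Sum.inr l ∉ S → Joined (.inr l) (.inl (f t₁, 0)) := fun l hl =>
    trans (step hl (point h₁ (l.1 * f t₁ - l.2)) (by simp)) (column _ _)
  have all : ∀ u, u ∉ S → Joined u (.inl (f t₁, 0)) := by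
    rintro (p | l) hu
    · exact trans (step hu (line h₁ (f t₁ * p.1 - p.2)) (by simp)) (lines _ (line h₁ _))
    · exact lines l hu
  have : Nonempty {v | v ∉ S} := ⟨⟨_, point h₁ 0⟩⟩
  refine ⟨fun u v => ?_⟩
  obtain ⟨_, _, hu⟩ := all u.1 u.2
  obtain ⟨_, _, hv⟩ := all v.1 v.2
  exact hu.trans hv.symm

end affineIncidence

/-! ### Connectivity of the incidence graphs -/

theorem IsKConnected.le_connectivity {n k : ℕ} {G : SimpleGraph (Fin n)} (h : IsKConnected k G) :
    k ≤ connectivity n G :=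
  -- The bound is essential: `sSup` of an unbounded set of naturals is 0.
  le_csSup ⟨n, fun _ hj => hj.1.le⟩ h

theorem isKConnected_of_iso {V : Type*} [Fintype V] {n k : ℕ} {Γ : SimpleGraph V}
    {G : SimpleGraph (Fin n)} (e : Γ ≃g G) (hk : k < n)
    (h : ∀ S : Finset V, S.card ≤ k → (Γ.induce {v | v ∉ S}).Connected) : IsKConnected k G := by
  refine ⟨hk, ?_, fun S hS => ?_⟩
  · refine (h ∅ (by simp)).map ⟨fun v => e v.1, fun {a b} hab => e.map_adj_iff.2 hab⟩ fun w => ?_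
    exact ⟨⟨e.symm w, by simp⟩, by simp⟩
  · have hmem : ∀ v, v ∈ S.map e.symm.toEquiv.toEmbedding ↔ e v ∈ S := fun v => by
      rw [Finset.mem_map_equiv]; rfl
    refine (h (S.map e.symm.toEquiv.toEmbedding) (by simp; omega)).map
      ⟨fun v => ⟨e v.1, fun hv => v.2 ((hmem _).2 hv)⟩, fun {a b} hab => e.map_adj_iff.2 hab⟩
      fun w => ⟨⟨e.symm w.1, fun hv => w.2 (by simpa using (hmem _).1 hv)⟩, ?_⟩
    exact Subtype.ext (e.apply_symm_apply w.1)

/-- The homomorphism `f` treats both rings at once: it will be the identity of $\mathbb{F}_p$ or the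
diagonal into $\mathbb{F}_p\times\mathbb{F}_p$. -/
theorem affineIncidence.exists_fin {R F : Type*} [CommRing R] [Finite R] [Nontrivial R] [Field F]
    [Fintype F] (f : F →+* R) (k : ℕ) (hk : 2 * k + 2 ≤ Fintype.card F) :
    ∃ (n : ℕ) (G : SimpleGraph (Fin n)), Nonempty (affineIncidence R ≃g G) ∧ G.Connected ∧
      k ≤ connectivity n G := by
  classical
  have := Fintype.ofFinite R
  have hcard : k < Fintype.card (R × R ⊕ R × R) := by
    have h : Function.Injective fun t : F => (Sum.inl (f t, 0) : R × R ⊕ R × R) :=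
      fun a b hab => f.injective (by simpa using hab)
    have := Fintype.card_le_of_injective _ h
    omega
  have hK := isKConnected_of_iso ((affineIncidence R).overFinIso rfl) hcard fun S hS =>
    connected_induce_compl f S (by omega)
  exact ⟨_, _, ⟨(affineIncidence R).overFinIso rfl⟩, hK.2.1, hK.le_connectivity⟩

/-! ### Copies of $C_4$ and $P_4$ -/

theorem cycleGraph_four_isContained_iff {V : Type*} {G : SimpleGraph V} :
    (SimpleGraph.cycleGraph 4).IsContained G ↔ ∃ a b c d, G.Adj a b ∧ G.Adj b c ∧ G.Adj c d ∧
      G.Adj d a ∧ a ≠ c ∧ b ≠ d := by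
  constructor
  · rintro ⟨f⟩
    refine ⟨f.toHom 0, f.toHom 1, f.toHom 2, f.toHom 3, f.toHom.map_adj (by decide),
      f.toHom.map_adj (by decide), f.toHom.map_adj (by decide), f.toHom.map_adj (by decide),
      fun h => ?_, fun h => ?_⟩
    · exact absurd (f.injective' h) (by decide)
    · exact absurd (f.injective' h) (by decide)
  · rintro ⟨a, b, c, d, hab, hbc, hcd, hda, hac, hbd⟩
    refine ⟨⟨⟨![a, b, c, d], fun {i j} hij => ?_⟩, fun i j hij => ?_⟩⟩
    · rw [SimpleGraph.cycleGraph_adj] at hij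
      fin_cases i <;> fin_cases j <;>
        first
        | exact absurd hij (by decide)
        | simp [hab, hbc, hcd, hda, hab.symm, hbc.symm, hcd.symm, hda.symm]
    · fin_cases i <;> fin_cases j <;> first
      | rfl
      | exfalso; revert hij; simp [hab.ne, hbc.ne, hcd.ne, hda.ne, hab.ne', hbc.ne', hcd.ne', hda.ne', hac, hbd,
          hac.symm, hbd.symm]

theorem pathGraph_four_isContained_iff {V : Type*} {G : SimpleGraph V} :
    (SimpleGraph.pathGraph 4).IsContained G ↔ ∃ a b c d, G.Adj a b ∧ G.Adj b c ∧ G.Adj c d ∧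
      a ≠ c ∧ b ≠ d ∧ a ≠ d := by
  constructor
  · rintro ⟨f⟩
    refine ⟨f.toHom 0, f.toHom 1, f.toHom 2, f.toHom 3, f.toHom.map_adj ?_,
      f.toHom.map_adj ?_, f.toHom.map_adj ?_, fun h => ?_, fun h => ?_, fun h => ?_⟩
    · simp [SimpleGraph.pathGraph_adj]
    · simp [SimpleGraph.pathGraph_adj]
    · simp [SimpleGraph.pathGraph_adj]
    · exact absurd (f.injective' h) (by decide)
    · exact absurd (f.injective' h) (by decide)
    · exact absurd (f.injective' h) (by decide)
  · rintro ⟨a, b, c, d, hab, hbc, hcd, hac, hbd, had⟩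
    refine ⟨⟨⟨![a, b, c, d], fun {i j} hij => ?_⟩, fun i j hij => ?_⟩⟩
    · rw [SimpleGraph.pathGraph_adj] at hij
      fin_cases i <;> fin_cases j <;>
        first
        | exact absurd hij (by decide)
        | simp [hab, hbc, hcd, hab.symm, hbc.symm, hcd.symm]
    · fin_cases i <;> fin_cases j <;> first
      | rfl
      | exfalso; revert hij; simp [hab.ne, hbc.ne, hcd.ne, had, hab.ne', hbc.ne', hcd.ne', had.symm, hac, hbd,
          hac.symm, hbd.symm]

/-- If two points lie on two common lines, the difference of slopes times the difference of
abscissae vanishes; in a field one factor is zero, and then the lines or the points coincide. -/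
theorem affineIncidence.not_isContained_cycleGraph_four (F : Type*) [Field F] :
    ¬ (SimpleGraph.cycleGraph 4).IsContained (affineIncidence F) := by
  have key : ∀ p q l m : F × F, p.2 + l.2 = l.1 * p.1 → q.2 + l.2 = l.1 * q.1 →
      p.2 + m.2 = m.1 * p.1 → q.2 + m.2 = m.1 * q.1 → p ≠ q → l = m := by
    intro p q l m h₁ h₂ h₃ h₄ hpq
    have h : (l.1 - m.1) * (p.1 - q.1) = 0 := by linear_combination h₂ + h₃ - h₁ - h₄
    rcases mul_eq_zero.1 h with h | h
    · exact Prod.ext (sub_eq_zero.1 h) (by linear_combination h₁ - h₃ + p.1 * h)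
    · exact absurd (Prod.ext (sub_eq_zero.1 h) (by linear_combination h₁ - h₂ + l.1 * h)) hpq
  rw [cycleGraph_four_isContained_iff]
  rintro ⟨a | a, b | b, c | c, d | d, h₁, h₂, h₃, h₄, hac, hbd⟩ <;>
    simp only [adj_inl_inr, adj_inr_inl, not_adj_inl_inl, not_adj_inr_inr] at h₁ h₂ h₃ h₄
  · exact hbd (congrArg _ (key a c b d h₁ h₂ h₄ h₃ fun h => hac (congrArg _ h)))
  · exact hac (congrArg _ (key b d a c h₁ h₄ h₂ h₃ fun h => hbd (congrArg _ h)))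

theorem affineIncidence.isContained_cycleGraph_four (F : Type*) [Field F] :
    (SimpleGraph.cycleGraph 4).IsContained (affineIncidence (F × F)) := by
  rw [cycleGraph_four_isContained_iff]
  -- The second point and the second line are incident because $(1,0)(0,1)=0$.
  exact ⟨.inl (0, 0), .inr (0, 0), .inl ((0, 1), 0), .inr ((1, 0), 0), by simp, by simp,
    by simp [Prod.ext_iff], by simp, by simp [Prod.ext_iff], by simp [Prod.ext_iff]⟩

theorem exists_indistinguishable_cycleGraph_four (k : ℕ) :
    ∃ (n m : ℕ) (G : SimpleGraph (Fin n)) (H : SimpleGraph (Fin m)), G.Connected ∧ H.Connected ∧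
      k ≤ connectivity n G ∧ k ≤ connectivity m H ∧
      ¬ (SimpleGraph.cycleGraph 4).IsContained G ∧ (SimpleGraph.cycleGraph 4).IsContained H ∧
      ∀ φ : GraphFormula, φ.IsSentence → φ.depth ≤ 3 ∨ φ.width ≤ 2 →
        (φ.TrueOn G ↔ φ.TrueOn H) := by
  obtain ⟨p, hp, hprime⟩ := Nat.exists_infinite_primes (2 * k + 2)
  have : Fact p.Prime := ⟨hprime⟩
  have hcard : 2 * k + 2 ≤ Fintype.card (ZMod p) := by rwa [ZMod.card]
  obtain ⟨n, G, ⟨e₁⟩, hG, hGk⟩ := affineIncidence.exists_fin (RingHom.id (ZMod p)) k hcard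
  obtain ⟨m, H, ⟨e₂⟩, hH, hHk⟩ := affineIncidence.exists_fin
    ((RingHom.id (ZMod p)).prod (RingHom.id (ZMod p))) k hcard
  refine ⟨n, m, G, H, hG, hH, hGk, hHk, ?_, ?_, fun φ hφ h => ?_⟩
  · rw [← SimpleGraph.isContained_congr SimpleGraph.Iso.refl e₁]
    exact affineIncidence.not_isContained_cycleGraph_four _
  · rw [← SimpleGraph.isContained_congr SimpleGraph.Iso.refl e₂]
    exact affineIncidence.isContained_cycleGraph_four _
  · rw [← hφ.trueOn_iso e₁, ← hφ.trueOn_iso e₂]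
    have hG' := affineIncidence.triangleFreeRich (R := ZMod p)
    have hH' := affineIncidence.triangleFreeRich (R := ZMod p × ZMod p)
    rcases h with h | h
    · exact hφ.trueOn_iff_of_backForth h (hG'.backForth_three hH')
    · exact hφ.trueOn_iff_of_width_le_two hG'.noExtremeVertex hH'.noExtremeVertex h

/-! ### Stars and graphs without $P_4$ -/

/-- A walk from `x` to `y` must leave the closed neighbourhood of `x`, and it cannot do so directly
from `x`. -/
theorem SimpleGraph.Connected.exists_adj_adj_not_adj {V : Type*} {G : SimpleGraph V}
    (hG : G.Connected) {x y : V} (hyx : y ≠ x) (hxy : ¬ G.Adj x y) :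
    ∃ z u, G.Adj x z ∧ G.Adj z u ∧ u ≠ x ∧ ¬ G.Adj x u := by
  obtain ⟨p⟩ := hG.preconnected x y
  obtain ⟨d, -, h₁, h₂⟩ := p.exists_boundary_dart {v | v = x ∨ G.Adj x v} (Or.inl rfl)
    (by simp [hyx, hxy])
  simp only [Set.mem_ofPred_eq, not_or] at h₁ h₂
  rcases h₁ with h₁ | h₁
  · exact absurd (h₁ ▸ d.adj) h₂.2
  · exact ⟨_, _, h₁, d.adj, h₂⟩

/-- The vertex `x` is adjacent to all other vertices. -/
def IsUniversal {V : Type*} (G : SimpleGraph V) (x : V) : Prop := ∀ y, y = x ∨ G.Adj x y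

/-- The connected graphs with at least four vertices and no path on four vertices are the stars,
that is, the graphs in which every edge has exactly one universal end. -/
theorem pathGraph_four_isContained_iff_of_connected {n : ℕ} (hn : 4 ≤ n)
    {G : SimpleGraph (Fin n)} (hG : G.Connected) :
    (SimpleGraph.pathGraph 4).IsContained G ↔
      ∃ x y, G.Adj x y ∧ (IsUniversal G x ↔ IsUniversal G y) := by
  rw [pathGraph_four_isContained_iff]
  constructor
  · rintro ⟨a, b, c, d, hab, hbc, hcd, hac, hbd, had⟩
    by_contra! H
    by_cases hb : IsUniversal G b
    · have hc : ¬ IsUniversal G c := fun hc => by simpa [hb, hc] using H b c hbc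
      have hd : IsUniversal G d := by simpa [hc] using H c d hcd
      have := H b d ((hb d).resolve_left hbd.symm)
      simp [hb, hd] at this
    · have hc : IsUniversal G c := by simpa [hb] using H b c hbc
      have ha : IsUniversal G a := by simpa [hb] using H a b hab
      have := H a c ((ha c).resolve_left hac.symm)
      simp [ha, hc] at this
  · rintro ⟨x, y, hxy, h⟩
    by_cases hx : IsUniversal G x
    · have hy := h.1 hx
      -- Four vertices leave two to hang on the universal ends, as the path `z x y w`. In a triangle
      -- this fails.
      have hcard : 1 < (Finset.univ \ {x, y} : Finset (Fin n)).card := by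
        have h₁ := Finset.le_card_sdiff {x, y} (Finset.univ : Finset (Fin n))
        have h₂ : ({x, y} : Finset (Fin n)).card ≤ 2 := Finset.card_le_two
        rw [Finset.card_univ, Fintype.card_fin] at h₁
        omega
      obtain ⟨z, hz, w, hw, hzw⟩ := Finset.one_lt_card.1 hcard
      simp only [Finset.mem_sdiff, Finset.mem_univ, true_and, Finset.mem_insert,
        Finset.mem_singleton, not_or] at hz hw
      exact ⟨z, x, y, w, ((hx z).resolve_left hz.1).symm, hxy, (hy w).resolve_left hw.2, hz.2,
        Ne.symm hw.1, hzw⟩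
    · have hy : ¬ IsUniversal G y := fun hy => hx (h.2 hy)
      simp only [IsUniversal, not_forall, not_or] at hx hy
      obtain ⟨x₀, hx₁, hx₂⟩ := hx
      obtain ⟨y₀, hy₁, hy₂⟩ := hy
      obtain ⟨z, u, hxz, hzu, hux, hxu⟩ := hG.exists_adj_adj_not_adj hx₁ hx₂
      obtain ⟨z', u', hyz', hzu', huy', hyu'⟩ := hG.exists_adj_adj_not_adj hy₁ hy₂
      by_cases hzy : z = y
      · by_cases hzx : z' = x
        · subst hzy hzx
          -- Each of `x`, `y` reaches distance two only through the other, so the edge extends at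
          -- both ends; `u` is adjacent to `y` and `u'` is not.
          exact ⟨u', z', z, u, hzu'.symm, hxy, hzu, huy', hux.symm, fun h => hyu' (h ▸ hzu)⟩
        · exact ⟨x, y, z', u', hxy, hyz', hzu', Ne.symm hzx, huy'.symm,
            fun h => hyu' (h ▸ hxy.symm)⟩
      · exact ⟨y, x, z, u, hxy.symm, hxz, hzu, Ne.symm hzy, hux.symm, fun h => hxu (h ▸ hxy)⟩

/-- The star with centre `0`, possibly with an additional edge between `1` and `2`. -/
def starWith (P : Prop) (n : ℕ) : SimpleGraph (Fin (n + 4)) where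
  Adj i j := i ≠ j ∧ (i.1 = 0 ∨ j.1 = 0 ∨ P ∧ (i.1 = 1 ∨ i.1 = 2) ∧ (j.1 = 1 ∨ j.1 = 2))
  symm := ⟨fun i j h => ⟨h.1.symm, by tauto⟩⟩
  loopless := ⟨fun i h => h.1 rfl⟩

namespace starWith

variable (P : Prop) (n : ℕ)

theorem adj_zero {j : Fin (n + 4)} (h : j ≠ 0) : (starWith P n).Adj 0 j := ⟨h.symm, .inl rfl⟩

theorem connected : (starWith P n).Connected := by
  have h : ∀ j, (starWith P n).Reachable 0 j := fun j => by
    by_cases hj : j = 0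
    · rw [hj]
    · exact (adj_zero P n hj).reachable
  exact ⟨fun i j => (h i).symm.trans (h j)⟩

theorem exists_adj (i : Fin (n + 4)) : ∃ j, (starWith P n).Adj i j := by
  by_cases hi : i = 0
  · exact ⟨⟨1, by omega⟩, hi ▸ adj_zero P n (by simp)⟩
  · exact ⟨0, (adj_zero P n hi).symm⟩

theorem exists_not_adj : ∃ i j : Fin (n + 4), j ≠ i ∧ ¬ (starWith P n).Adj i j :=
  -- These two leaves are non-adjacent whether or not the extra edge is present.
  ⟨⟨1, by omega⟩, ⟨3, by omega⟩, by simp, by simp [starWith]⟩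

theorem backForth_two (Q : Prop) (m : ℕ) :
    GraphFormula.BackForth (starWith P n) (starWith Q m) 2 [] :=
  GraphFormula.backForth_two (exists_adj P n) (exists_adj Q m)
    ⟨0, fun _ hy => adj_zero P n hy⟩ ⟨0, fun _ hy => adj_zero Q m hy⟩
    (exists_not_adj P n) (exists_not_adj Q m)

theorem isContained_pathGraph_four :
    (SimpleGraph.pathGraph 4).IsContained (starWith P n) ↔ P := by
  rw [pathGraph_four_isContained_iff]
  constructor
  · rintro ⟨a, b, c, d, ⟨_, hab⟩, ⟨_, hbc⟩, ⟨_, hcd⟩, hac, hbd, had⟩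
    by_contra hP
    simp only [hP, false_and, or_false] at hab hbc hcd
    omega
  · intro hP
    refine ⟨⟨1, by omega⟩, ⟨2, by omega⟩, ⟨0, by omega⟩, ⟨3, by omega⟩, ?_, ?_, ?_, ?_, ?_, ?_⟩ <;>
      simp [starWith, hP]

end starWith

/-! ### Defining sentences -/

namespace GraphFormula

/-- The formula saying that the variable `i` is a universal vertex, with the auxiliary
variable `j`. -/
def universal (i j : ℕ) : GraphFormula := .all j (.or (.eq j i) (.adj i j))

theorem sat_universal {V : Type*} (G : SimpleGraph V) {i j : ℕ} (hij : i ≠ j) (s : ℕ → V) :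
    Sat G (universal i j) s ↔ IsUniversal G (s i) := by
  simp [universal, Sat, IsUniversal, hij]

/-- There is an edge with two or no universal ends. -/
def pathSentence : GraphFormula :=
  .ex 0 (.ex 1 (.and (.adj 0 1) (.or (.and (universal 0 1) (universal 1 0))
    (.and (.neg (universal 0 1)) (.neg (universal 1 0))))))

/-- The threshold 4 excludes the single edge and the triangle, which satisfy the sentence but
contain no $P_4$. -/
theorem definesOver_pathSentence :
    DefinesOver vertexCount 4 (subgraphClass (SimpleGraph.pathGraph 4)) pathSentence := by
  have hs : pathSentence.IsSentence := by unfold IsSentence; decide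
  refine ⟨hs, fun n G hG hn => ?_⟩
  have : Nonempty (Fin n) := hG.nonempty
  rw [hs.trueOn_iff_sat G fun _ => Classical.arbitrary (Fin n), subgraphClass,
    pathGraph_four_isContained_iff_of_connected (show 4 ≤ n from hn) hG]
  simp only [pathSentence, Sat, sat_universal G zero_ne_one, sat_universal G one_ne_zero]
  simp [iff_iff_and_or_not_and_not]

/-- There is a cycle on four vertices. -/
def cycleSentence : GraphFormula :=
  .ex 0 (.ex 1 (.ex 2 (.ex 3 (.and (.adj 0 1) (.and (.adj 1 2) (.and (.adj 2 3) (.and (.adj 3 0)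
    (.and (.neg (.eq 0 2)) (.neg (.eq 1 3))))))))))

theorem definesOver_cycleSentence (π : GraphParameter) :
    DefinesOver π 0 (subgraphClass (SimpleGraph.cycleGraph 4)) cycleSentence := by
  have hs : cycleSentence.IsSentence := by unfold IsSentence; decide
  refine ⟨hs, fun n G hG _ => ?_⟩
  have : Nonempty (Fin n) := hG.nonempty
  rw [hs.trueOn_iff_sat G fun _ => Classical.arbitrary (Fin n), subgraphClass,
    cycleGraph_four_isContained_iff]
  simp [cycleSentence, Sat]

end GraphFormula

/-! ### Bounds for depth and width -/

theorem depthParam_le {π : GraphParameter} {k : ℕ} {C : GraphClass} {Φ : GraphFormula}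
    (h : DefinesOver π k C Φ) : depthParam π C ≤ Φ.depth :=
  (iInf_le _ k).trans (iInf₂_le Φ h)

theorem widthParam_le {π : GraphParameter} {k : ℕ} {C : GraphClass} {Φ : GraphFormula}
    (h : DefinesOver π k C Φ) : widthParam π C ≤ Φ.width :=
  (iInf_le _ k).trans (iInf₂_le Φ h)

theorem le_depthParam {π : GraphParameter} {C : GraphClass} {d : ℕ}
    (h : ∀ k Φ, DefinesOver π k C Φ → d ≤ Φ.depth) : (d : ℕ∞) ≤ depthParam π C :=
  le_iInf fun k => le_iInf₂ fun Φ hΦ => Nat.cast_le.2 (h k Φ hΦ)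

theorem le_widthParam {π : GraphParameter} {C : GraphClass} {d : ℕ}
    (h : ∀ k Φ, DefinesOver π k C Φ → d ≤ Φ.width) : (d : ℕ∞) ≤ widthParam π C :=
  le_iInf fun k => le_iInf₂ fun Φ hΦ => Nat.cast_le.2 (h k Φ hΦ)

theorem not_trueOn_starWith_iff {k : ℕ} {Φ : GraphFormula}
    (h : DefinesOver vertexCount k (subgraphClass (SimpleGraph.pathGraph 4)) Φ) :
    ¬ (Φ.TrueOn (starWith False k) ↔ Φ.TrueOn (starWith True k)) := by
  have hk : k ≤ k + 4 := Nat.le_add_right k 4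
  rw [h.2 _ _ (starWith.connected False k) hk, h.2 _ _ (starWith.connected True k) hk]
  simp [subgraphClass, starWith.isContained_pathGraph_four]

theorem not_depth_le_or_width_le_of_definesOver_cycleGraph_four {k : ℕ} {Φ : GraphFormula}
    (h : DefinesOver connectivity k (subgraphClass (SimpleGraph.cycleGraph 4)) Φ) :
    ¬ (Φ.depth ≤ 3 ∨ Φ.width ≤ 2) := by
  intro hΦ
  obtain ⟨n, m, G, H, hG, hH, hGk, hHk, hGC, hHC, hiff⟩ :=
    exists_indistinguishable_cycleGraph_four k
  exact hGC ((h.2 n G hG hGk).1 ((hiff Φ h.1 hΦ).2 ((h.2 m H hH hHk).2 hHC)))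

theorem theorem6p1 :
    (widthParam vertexCount (subgraphClass (SimpleGraph.pathGraph 4)) = 2 ∧
      depthParam vertexCount (subgraphClass (SimpleGraph.pathGraph 4)) = 3) ∧
    (depthParam connectivity (subgraphClass (SimpleGraph.cycleGraph 4)) = 4 ∧
      3 ≤ widthParam connectivity (subgraphClass (SimpleGraph.cycleGraph 4))) := by
  refine ⟨⟨le_antisymm ?_ ?_, le_antisymm ?_ ?_⟩, le_antisymm ?_ ?_, ?_⟩
  · exact widthParam_le GraphFormula.definesOver_pathSentence
  · refine le_widthParam (d := 2) fun k Φ h => not_lt.1 fun hlt => not_trueOn_starWith_iff h ?_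
    exact h.1.trueOn_iff_of_width_le_one _ _ (Nat.le_of_lt_succ hlt)
  · exact depthParam_le GraphFormula.definesOver_pathSentence
  · refine le_depthParam (d := 3) fun k Φ h => not_lt.1 fun hlt => not_trueOn_starWith_iff h ?_
    exact h.1.trueOn_iff_of_backForth (Nat.le_of_lt_succ hlt) (starWith.backForth_two _ k _ k)
  · exact depthParam_le (GraphFormula.definesOver_cycleSentence connectivity)
  · exact le_depthParam (d := 4) fun k Φ h => not_lt.1 fun hlt =>
      not_depth_le_or_width_le_of_definesOver_cycleGraph_four h (.inl (Nat.le_of_lt_succ hlt))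
  · exact le_widthParam (d := 3) fun k Φ h => not_lt.1 fun hlt =>
      not_depth_le_or_width_le_of_definesOver_cycleGraph_four h (.inr (Nat.le_of_lt_succ hlt))
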